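/- Let $\tau\ge 1$. For an integer $n\ge 1$ put $\mathbb{Z}_n=\{0,\dots,n-1\}$ and let $f:\mathbb{Z}_n^2\to\mathbb{Z}_n$ be a rule chosen uniformly at random from all $n^{n^2}$ such maps. A label of length $\tau$ is a word $A=a_0\dots a_{\tau-1}$ over $\mathbb{Z}_n$; indices of labels are read modulo $\tau$. For labels $A=a_0\dots a_{\tau-1}$ and $B=b_0\dots b_{\tau-1}$: - $A\to B$ ($A$ right-extends to $B$) means $f(a_i,b_i)=b_{i+1}$ for all $i$; - $A\Rightarrow B$ ($A$ decides $B$) means that $A\to B$ and that for every $c_0\in\mathbb{Z}_n$ the sequence $c_{j+1}=f(a_{j \bmod \tau},c_j)$ satisfies $c_j=b_{j\bmod\tau}$ for some $j\ge 0$; - $G_{\tau,n}(f,A)$ is the digraph with nodes $(i,j)$, $0\le i<\tau$, $0\le j<n$ ($i$ read modulo $\tau$), and an arc $(i,j)\to(i+1,j')$ whenever $f(a_i,j)=j'$; - $\mathcal{E}(A,B)$ is the set of digraphs on these nodes, with all arcs leading from a part $(i,\ast)$ to the part $(i+1,\ast)$, that contain the cycle $(0,b_0)\to(1,b_1)\to\dots\to(\tau-1,b_{\tau-1})\to(0,b_0)$,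 and $\mathcal{D}(A,B)$ is the set of those digraphs in $\mathcal{E}(A,B)$ in which every node has a directed path to $(0,b_0)$. Theorem. Let $A,B$ be two fixed labels of length $\tau$, not necessarily simple (that is, states may be repeated). Then, as $n\to\infty$, $$\mathbb{P}\left(G_{\tau,n}(f,A)\in\mathcal{D}(A,B)\bigm| G_{\tau,n}(f,A)\in\mathcal{E}(A,B)\right)=o(1),$$ and, equivalently, $$\mathbb{P}\left(A\Rightarrow B\bigm| A\to B\right)=o(1).$$ (If no rule satisfies $A\to B$, the conditional probabilities are understood to be $0$.) -/

import Mathlib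

open Set Filter Topology MeasureTheory ProbabilityTheory

/-- A `2`-neighbor cellular automaton rule with state space `ℤ_n = {0, …, n - 1}`. -/
abbrev Rule (n : ℕ) : Type := Fin n × Fin n → Fin n

/-- The law of a rule chosen uniformly from all `n ^ (n ^ 2)` rules. -/
noncomputable def uniformRule (n : ℕ) : Measure (Rule n) := uniformOn univ

/-- A label of length `τ`: a word `a_0 … a_{τ-1}` over `ℤ_n`. Addition on the index type `Fin τ`
is addition modulo `τ`. -/
abbrev Label (τ n : ℕ) : Type := Fin τ → Fin n

/-- `A → B`: the label `A` right-extends to `B` under the rule `f`. -/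
def RightExtends {τ n : ℕ} [NeZero τ] (f : Rule n) (A B : Label τ n) : Prop :=
  ∀ i : Fin τ, f (A i, B i) = B (i + 1)

/-- The sequence `c_0, c_1, …` with `c_{j+1} = f (a_{j mod τ}, c_j)`. -/
def orbit {τ n : ℕ} [NeZero τ] (f : Rule n) (A : Label τ n) (c₀ : Fin n) : ℕ → Fin n
  | 0 => c₀
  | j + 1 => f (A (Fin.ofNat τ j), orbit f A c₀ j)

/-- `A ⇒ B`: the label `A` decides `B` under the rule `f`. -/
def Decides {τ n : ℕ} [NeZero τ] (f : Rule n) (A B : Label τ n) : Prop :=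
  RightExtends f A B ∧
    ∀ c₀ : Fin n, ∃ j : ℕ, orbit f A c₀ j = B (Fin.ofNat τ j)

/-- The label assignment digraph of `A` under `f`: its nodes are the pairs `(i, j)`, and there is
an arc `(i, j) → (i + 1, j')` exactly when `f (a_i, j) = j'`. -/
def labelAssignmentDigraph {τ n : ℕ} [NeZero τ] (f : Rule n) (A : Label τ n) :
    Digraph (Fin τ × Fin n) where
  Adj p q := q.1 = p.1 + 1 ∧ f (A p.1, p.2) = q.2

/-- The `τ`-partite digraphs with parts `(i, *)`, all arcs leading from a part to the cyclically
next one. -/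
def IsCyclicallyPartite {τ n : ℕ} [NeZero τ] (G : Digraph (Fin τ × Fin n)) : Prop :=
  ∀ p q, G.Adj p q → q.1 = p.1 + 1

/-- The set `ℰ(A, B)`, which depends on `B` only: the `τ`-partite digraphs containing the cycle
`(0, b_0) → (1, b_1) → ⋯ → (τ - 1, b_{τ-1}) → (0, b_0)`. -/
def extendingDigraphs {τ n : ℕ} [NeZero τ] (B : Label τ n) : Set (Digraph (Fin τ × Fin n)) :=
  {G | IsCyclicallyPartite G ∧ ∀ i : Fin τ, G.Adj (i, B i) (i + 1, B (i + 1))}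

/-- The set `𝒟(A, B)`, which depends on `B` only: the digraphs in `ℰ(A, B)` in which every node
has a directed path to `(0, b_0)`. -/
def decidingDigraphs {τ n : ℕ} [NeZero τ] (B : Label τ n) : Set (Digraph (Fin τ × Fin n)) :=
  {G | G ∈ extendingDigraphs B ∧
    ∀ p : Fin τ × Fin n, Relation.ReflTransGen G.Adj p (0, B 0)}

/-! Fix a state `c` outside `B`. Both deciding conditions force the orbit of `c` to meet `range B`,
and this is rare among the rules with `A → B`. Cut at the first hit and redirect the hitting arc; `A
→ B` survives. If the hit is early (`t < τ * K`), any of `n` targets is allowed, and the result, the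
time and the label index hit recover the rule (`card_firstHit_lt_mul_le`). If it is late, redirect
to one of `K` earlier orbit states at distance a multiple of `τ`: the loop reveals the time, so only
the label index is recorded (`card_le_firstHit_mul_le`). Taking `K * K ≤ n` bounds the conditional
probability by `(τ * τ + τ) / K`. -/

lemma Fin.ofNat_succ_eq_add_one (τ j : ℕ) [NeZero τ] :
    Fin.ofNat τ (j + 1) = Fin.ofNat τ j + 1 := by
  apply Fin.ext
  simp [Fin.val_add]

section Orbit

variable {τ n : ℕ} [NeZero τ]

/-- A coincidence of the orbit with itself at times congruent modulo `τ` makes it periodic. -/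
lemma orbit_add_of_coincidence {f : Rule n} {A : Label τ n} {c : Fin n} {s q : ℕ}
    (h : orbit f A c (s + τ * q) = orbit f A c s) (d : ℕ) :
    orbit f A c (s + d + τ * q) = orbit f A c (s + d) := by
  induction d with
  | zero => simpa using h
  | succ d ih =>
    have e : s + (d + 1) + τ * q = (s + d + τ * q) + 1 := by ring
    have e' : Fin.ofNat τ (s + d + τ * q) = Fin.ofNat τ (s + d) := by
      apply Fin.ext
      simp
    rw [e, ← add_assoc s d 1, orbit, orbit, ih, e']

/-- Changing the rule at one argument does not change the orbit until that argument is used. -/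
lemma orbit_update {f : Rule n} {A : Label τ n} {c : Fin n} {N : ℕ} {p : Fin n × Fin n}
    (hp : ∀ s < N, (A (Fin.ofNat τ s), orbit f A c s) ≠ p) (y : Fin n) :
    ∀ t ≤ N, orbit (Function.update f p y) A c t = orbit f A c t := by
  intro t
  induction t with
  | zero => intro _; rfl
  | succ t ih =>
    intro ht
    rw [orbit, orbit, ih (by lia), Function.update_of_ne (hp t (by lia))]

/-- The orbit of `c` meets the states of `B` at time `t + 1` and not earlier. -/
def FirstHit (f : Rule n) (A B : Label τ n) (c : Fin n) (t : ℕ) : Prop :=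
  orbit f A c (t + 1) ∈ range B ∧ ∀ s ≤ t, orbit f A c s ∉ range B

lemma exists_firstHit {f : Rule n} {A B : Label τ n} {c : Fin n} (hc : c ∉ range B)
    (h : ∃ t, orbit f A c t ∈ range B) : ∃ t, FirstHit f A B c t := by
  classical
  obtain ⟨t, ht⟩ : ∃ t, Nat.find h = t + 1 := by
    refine Nat.exists_eq_succ_of_ne_zero fun h0 => hc ?_
    have := Nat.find_spec h
    rwa [h0] at this
  refine ⟨t, ht ▸ Nat.find_spec h, fun s hs => Nat.find_min h (by lia)⟩

/-- The argument of the rule whose value is the first state of `B` on the orbit, if this happens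
at time `t + 1`. -/
def lastArg (f : Rule n) (A : Label τ n) (c : Fin n) (t : ℕ) : Fin n × Fin n :=
  (A (Fin.ofNat τ t), orbit f A c t)

/-- The rule `f` with its value at the argument used at time `t` replaced by `y`. -/
def reroute (f : Rule n) (A : Label τ n) (c : Fin n) (t : ℕ) (y : Fin n) : Rule n :=
  Function.update f (lastArg f A c t) y

namespace FirstHit

variable {f g : Rule n} {A B : Label τ n} {c : Fin n} {t u : ℕ}

/-- An earlier use of the hitting argument would already have produced the hit. -/
lemma arg_ne (h : FirstHit f A B c t) :
    ∀ s < t, (A (Fin.ofNat τ s), orbit f A c s) ≠ lastArg f A c t := by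
  intro s hs e
  apply h.2 (s + 1) hs
  have : orbit f A c (s + 1) = orbit f A c (t + 1) := congrArg f e
  rw [this]
  exact h.1

lemma orbit_reroute (h : FirstHit f A B c t) (y : Fin n) {s : ℕ} (hs : s ≤ t) :
    orbit (reroute f A c t y) A c s = orbit f A c s :=
  orbit_update h.arg_ne y s hs

lemma orbit_reroute_succ (h : FirstHit f A B c t) (y : Fin n) :
    orbit (reroute f A c t y) A c (t + 1) = y := by
  rw [orbit, h.orbit_reroute y le_rfl]
  exact Function.update_self ..

/-- Right extension only constrains arguments whose second entry lies in `B`; the orbit at time `t`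
is still outside `B`. -/
lemma rightExtends_reroute (h : FirstHit f A B c t) (hf : RightExtends f A B) (y : Fin n) :
    RightExtends (reroute f A c t y) A B := by
  intro i
  rw [← hf i]
  refine Function.update_of_ne (fun e => h.2 t le_rfl ⟨i, congrArg Prod.snd e⟩) _ _

/-- Before it meets `B`, the orbit has no coincidences at times congruent modulo `τ`. -/
lemma orbit_ne (h : FirstHit f A B c t) {s q : ℕ} (hq : 0 < q) (hs : s + τ * q ≤ t + 1) :
    orbit f A c (s + τ * q) ≠ orbit f A c s := by
  intro e
  have hτ : 0 < τ * q := Nat.mul_pos (NeZero.pos τ) hq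
  -- Periodicity carries the hit back by `τ * q`, to a time at most `t`.
  have h1 := orbit_add_of_coincidence e (t + 1 - (s + τ * q))
  rw [show s + (t + 1 - (s + τ * q)) + τ * q = t + 1 by lia] at h1
  exact h.2 _ (by lia) (h1 ▸ h.1)

/-- A rule is determined by a rerouting of it, the time of rerouting and the original value. -/
lemma eq_of_reroute_eq (hf : FirstHit f A B c t) (hg : FirstHit g A B c t) {y z : Fin n}
    (h : reroute f A c t y = reroute g A c t z)
    (hv : orbit f A c (t + 1) = orbit g A c (t + 1)) : f = g := by
  have ho : orbit f A c t = orbit g A c t := by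
    rw [← hf.orbit_reroute y le_rfl, h, hg.orbit_reroute z le_rfl]
  have hp : lastArg f A c t = lastArg g A c t := by rw [lastArg, lastArg, ho]
  funext p
  by_cases e : p = lastArg f A c t
  · rw [e]
    have : f (lastArg f A c t) = g (lastArg g A c t) := hv
    rw [this, hp]
  · have := congrFun h p
    rwa [reroute, reroute, Function.update_of_ne e, Function.update_of_ne (hp ▸ e)] at this

/-- If the orbit is rerouted to a loop, the time of rerouting can be read off the result. -/
lemma time_le_of_loop (hf : FirstHit f A B c t) (hg : FirstHit g A B c u) {z : Fin n}
    {s q : ℕ} (hq : 0 < q) (hs : s + τ * q = t + 1)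
    (h : reroute f A c t (orbit f A c s) = reroute g A c u z) : u ≤ t := by
  by_contra! hlt
  have hτ : 0 < τ * q := Nat.mul_pos (NeZero.pos τ) hq
  -- If `t < u`, the orbit of `g` agrees with the rerouted one through time `t + 1`, so it contains
  -- the loop before its own hit.
  apply hg.orbit_ne hq (s := s) (by lia)
  rw [hs, ← hg.orbit_reroute z (s := t + 1) (by lia), ← hg.orbit_reroute z (s := s) (by lia), ← h,
    hf.orbit_reroute_succ, hf.orbit_reroute _ (by lia)]

end FirstHit

/-! ### Counting rules by rerouting -/

/-- Few rules let the orbit of `c` meet `B` early: the hitting arc can be rerouted anywhere. -/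
lemma card_firstHit_lt_mul_le (A B : Label τ n) (c : Fin n) (N : ℕ) :
    Nat.card {f : Rule n // RightExtends f A B ∧ ∃ t < N, FirstHit f A B c t} * n ≤
      Nat.card {f : Rule n // RightExtends f A B} * (N * τ) := by
  have key (f : {f : Rule n // RightExtends f A B ∧ ∃ t < N, FirstHit f A B c t}) :
      ∃ p : Fin N × Fin τ, FirstHit f.1 A B c p.1 ∧ B p.2 = orbit f.1 A c (p.1 + 1) := by
    obtain ⟨t, htN, ht⟩ := f.2.2
    obtain ⟨j, hj⟩ := ht.1
    exact ⟨(⟨t, htN⟩, j), ht, hj⟩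
  choose p hp hB using key
  let Φ : {f : Rule n // RightExtends f A B ∧ ∃ t < N, FirstHit f A B c t} × Fin n →
      {f : Rule n // RightExtends f A B} × (Fin N × Fin τ) := fun x =>
    (⟨reroute x.1.1 A c (p x.1).1 x.2, (hp x.1).rightExtends_reroute x.1.2.1 x.2⟩, p x.1)
  have hΦ : Function.Injective Φ := by
    rintro ⟨f, y⟩ ⟨g, z⟩ h
    have h1 : reroute f.1 A c (p f).1 y = reroute g.1 A c (p g).1 z :=
      congrArg (fun x => x.1.1) h
    have h2 : p f = p g := congrArg Prod.snd h
    have hg := hp g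
    have hBg := hB g
    rw [← h2] at h1 hg hBg
    have hfg : f = g :=
      Subtype.ext ((hp f).eq_of_reroute_eq hg h1 ((hB f).symm.trans hBg))
    have hyz : y = z := by
      rw [← (hp f).orbit_reroute_succ y, h1, hg.orbit_reroute_succ z]
    rw [hfg, hyz]
  simpa [Nat.card_prod] using Nat.card_le_card_of_injective Φ hΦ

/-- Few rules let the orbit of `c` meet `B` late: the hitting arc can be rerouted to close a loop
in many ways. -/
lemma card_le_firstHit_mul_le (A B : Label τ n) (c : Fin n) (K : ℕ) :
    Nat.card {f : Rule n // RightExtends f A B ∧ ∃ t, τ * K ≤ t ∧ FirstHit f A B c t} * K ≤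
      Nat.card {f : Rule n // RightExtends f A B} * τ := by
  have key (f : {f : Rule n // RightExtends f A B ∧ ∃ t, τ * K ≤ t ∧ FirstHit f A B c t}) :
      ∃ t, ∃ j : Fin τ, τ * K ≤ t ∧ FirstHit f.1 A B c t ∧ B j = orbit f.1 A c (t + 1) := by
    obtain ⟨t, htK, ht⟩ := f.2.2
    obtain ⟨j, hj⟩ := ht.1
    exact ⟨t, j, htK, ht, hj⟩
  choose T J hT hp hB using key
  have hs (f) (q : Fin K) : T f + 1 - τ * (q + 1) + τ * (q + 1) = T f + 1 := by
    have : τ * (q + 1) ≤ τ * K := Nat.mul_le_mul_left _ q.2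
    exact Nat.sub_add_cancel (this.trans ((hT f).trans (Nat.le_succ _)))
  let Φ : {f : Rule n // RightExtends f A B ∧ ∃ t, τ * K ≤ t ∧ FirstHit f A B c t} × Fin K →
      {f : Rule n // RightExtends f A B} × Fin τ := fun x =>
    (⟨reroute x.1.1 A c (T x.1) (orbit x.1.1 A c (T x.1 + 1 - τ * (x.2 + 1))),
      (hp x.1).rightExtends_reroute x.1.2.1 _⟩, J x.1)
  have hΦ : Function.Injective Φ := by
    rintro ⟨f, q⟩ ⟨g, r⟩ h
    have h1 : reroute f.1 A c (T f) (orbit f.1 A c (T f + 1 - τ * (q + 1))) =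
        reroute g.1 A c (T g) (orbit g.1 A c (T g + 1 - τ * (r + 1))) :=
      congrArg (fun x => x.1.1) h
    have h2 : J f = J g := congrArg Prod.snd h
    have hTT : T f = T g := le_antisymm
      ((hp g).time_le_of_loop (hp f) r.1.succ_pos (hs g r) h1.symm)
      ((hp f).time_le_of_loop (hp g) q.1.succ_pos (hs f q) h1)
    have hfg : f = g := by
      have hg := hp g
      have hBg := hB g
      rw [← hTT] at h1 hg hBg
      rw [← h2] at hBg
      exact Subtype.ext ((hp f).eq_of_reroute_eq hg h1 ((hB f).symm.trans hBg))
    subst hfg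
    have ho : orbit f.1 A c (T f + 1 - τ * (q + 1)) = orbit f.1 A c (T f + 1 - τ * (r + 1)) := by
      rw [← (hp f).orbit_reroute_succ (orbit f.1 A c (T f + 1 - τ * (q + 1))), h1,
        (hp f).orbit_reroute_succ]
    -- Distinct loop targets lie a positive multiple of `τ` apart on the orbit before the hit, so
    -- they are distinct states.
    have aux (q r : Fin K) (hlt : q < r) :
        orbit f.1 A c (T f + 1 - τ * (q + 1)) ≠ orbit f.1 A c (T f + 1 - τ * (r + 1)) := by
      obtain ⟨d, hd⟩ := Nat.exists_eq_add_of_lt (Fin.lt_def.1 hlt)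
      have e : τ * (r + 1 : ℕ) = τ * (q + 1) + τ * (d + 1) := by rw [hd]; ring
      have := hs f q
      have := hs f r
      have := (hp f).orbit_ne d.succ_pos (s := T f + 1 - τ * (r + 1)) (by lia)
      rwa [show T f + 1 - τ * (r + 1) + τ * (d + 1) = T f + 1 - τ * (q + 1) by lia] at this
    have hqr : q = r := by
      rcases lt_trichotomy q r with hlt | heq | hlt
      · exact absurd ho (aux q r hlt)
      · exact heq
      · exact absurd ho.symm (aux r q hlt)
    rw [hqr]
  simpa [Nat.card_prod] using Nat.card_le_card_of_injective Φ hΦ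

lemma card_hit_mul_le (A B : Label τ n) {c : Fin n} (hc : c ∉ range B) {K : ℕ}
    (hK : 0 < K) (hKn : K * K ≤ n) :
    Nat.card {f : Rule n // RightExtends f A B ∧ ∃ t, orbit f A c t ∈ range B} * K ≤
      Nat.card {f : Rule n // RightExtends f A B} * (τ * τ + τ) := by
  have h1 := card_firstHit_lt_mul_le A B c (τ * K)
  have h2 := card_le_firstHit_mul_le A B c K
  have h3 : Nat.card {f : Rule n // RightExtends f A B ∧ ∃ t, orbit f A c t ∈ range B} ≤
      Nat.card {f : Rule n // RightExtends f A B ∧ ∃ t < τ * K, FirstHit f A B c t} +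
      Nat.card {f : Rule n // RightExtends f A B ∧ ∃ t, τ * K ≤ t ∧ FirstHit f A B c t} := by
    refine le_trans (Set.ncard_le_ncard ?_ (Set.toFinite _)) (Set.ncard_union_le
      {f : Rule n | RightExtends f A B ∧ ∃ t < τ * K, FirstHit f A B c t}
      {f : Rule n | RightExtends f A B ∧ ∃ t, τ * K ≤ t ∧ FirstHit f A B c t})
    rintro f ⟨hf, ht⟩
    obtain ⟨t, ht⟩ := exists_firstHit hc ht
    rcases lt_or_ge t (τ * K) with hlt | hle
    · exact Or.inl ⟨hf, t, hlt, ht⟩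
    · exact Or.inr ⟨hf, t, hle, ht⟩
  generalize Nat.card {f : Rule n // RightExtends f A B ∧ ∃ t < τ * K, FirstHit f A B c t} = x at *
  generalize Nat.card
    {f : Rule n // RightExtends f A B ∧ ∃ t, τ * K ≤ t ∧ FirstHit f A B c t} = y at *
  generalize Nat.card {f : Rule n // RightExtends f A B} = e at *
  -- `K * K ≤ n` brings the early bound to the same order as the late one.
  have h4 : x * K ≤ e * (τ * τ) := by
    refine Nat.le_of_mul_le_mul_right (c := K) ?_ hK
    calc x * K * K = x * (K * K) := by ring
      _ ≤ x * n := Nat.mul_le_mul_left _ hKn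
      _ ≤ e * (τ * K * τ) := h1
      _ = e * (τ * τ) * K := by ring
  calc _ ≤ (x + y) * K := Nat.mul_le_mul_right _ h3
    _ = x * K + y * K := by ring
    _ ≤ e * (τ * τ) + e * τ := add_le_add h4 h2
    _ = e * (τ * τ + τ) := by ring

/-! ### From counts to conditional probabilities -/

lemma labelAssignmentDigraph_mem_extendingDigraphs_iff {f : Rule n} {A B : Label τ n} :
    labelAssignmentDigraph f A ∈ extendingDigraphs B ↔ RightExtends f A B :=
  ⟨fun h i => (h.2 i).2, fun h => ⟨fun _ _ hpq => hpq.1, fun i => ⟨rfl, h i⟩⟩⟩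

lemma exists_orbit_eq_of_reflTransGen {f : Rule n} {A : Label τ n} {c : Fin n}
    {p : Fin τ × Fin n}
    (h : Relation.ReflTransGen (labelAssignmentDigraph f A).Adj (0, c) p) :
    ∃ t, p = (Fin.ofNat τ t, orbit f A c t) := by
  induction h with
  | refl => exact ⟨0, rfl⟩
  | tail _ hadj ih =>
    obtain ⟨t, rfl⟩ := ih
    refine ⟨t + 1, Prod.ext ?_ hadj.2.symm⟩
    rw [Fin.ofNat_succ_eq_add_one]
    exact hadj.1

lemma exists_orbit_mem_range_of_mem_decidingDigraphs {f : Rule n} {A B : Label τ n}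
    (h : labelAssignmentDigraph f A ∈ decidingDigraphs B) (c : Fin n) :
    ∃ t, orbit f A c t ∈ range B := by
  obtain ⟨t, ht⟩ := exists_orbit_eq_of_reflTransGen (h.2 (0, c))
  exact ⟨t, 0, congrArg Prod.snd ht⟩

lemma cond_rightExtends_le (A B : Label τ n) {c : Fin n} (hc : c ∉ range B) {K : ℕ}
    (hK : 0 < K) (hKn : K * K ≤ n) {D : Set (Rule n)}
    (hD : ∀ f ∈ D, ∃ t, orbit f A c t ∈ range B) :
    (uniformRule n)[D | {f | RightExtends f A B}] ≤ ((τ * τ + τ : ℕ) : ENNReal) / K := by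
  set E : Set (Rule n) := {f | RightExtends f A B} with hE
  have hcard : (E ∩ D).ncard * K ≤ E.ncard * (τ * τ + τ) :=
    le_trans (Nat.mul_le_mul_right _ (Set.ncard_le_ncard
      (t := {f | RightExtends f A B ∧ ∃ t, orbit f A c t ∈ range B})
      (fun f hf => ⟨hf.1, hD f hf.2⟩) (Set.toFinite _))) (card_hit_mul_le A B hc hK hKn)
  have hfin (S : Set (Rule n)) : Measure.count S = S.ncard := by
    rw [Measure.count_apply_finite _ S.toFinite, Set.ncard_eq_toFinset_card S]
  have hcond : (uniformRule n)[D | E] = (E.ncard : ENNReal)⁻¹ * (E ∩ D).ncard := by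
    rw [uniformRule, uniformOn, cond_cond_eq_cond_inter' MeasurableSet.univ
      (Set.toFinite _).measurableSet (by simp [hfin]), univ_inter,
      cond_apply (Set.toFinite _).measurableSet, hfin, hfin]
  rw [hcond]
  rcases Nat.eq_zero_or_pos E.ncard with h0 | hpos
  · have : (E ∩ D).ncard = 0 :=
      Nat.le_zero.1 (h0 ▸ Set.ncard_le_ncard Set.inter_subset_left (Set.toFinite _))
    simp [this]
  · rw [mul_comm, ← div_eq_mul_inv]
    refine ENNReal.div_le_of_le_mul ?_
    rw [← ENNReal.mul_div_right_comm, ENNReal.le_div_iff_mul_le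
      (Or.inl (by exact_mod_cast hK.ne')) (Or.inl (by simp))]
    rw [mul_comm _ (E.ncard : ENNReal)]
    exact_mod_cast hcard

end Orbit

lemma tendsto_cond_rightExtends {τ : ℕ} [NeZero τ] {m : ℕ} (A B : Label τ m)
    (D : ∀ k, Set (Rule (m + k)))
    (hD : ∀ k, ∀ f ∈ D k, ∀ c, ∃ t, orbit f (Fin.castAdd k ∘ A) c t ∈ range (Fin.castAdd k ∘ B)) :
    Tendsto (fun k : ℕ => (uniformRule (m + k))[D k |
      {f | RightExtends f (Fin.castAdd k ∘ A) (Fin.castAdd k ∘ B)}]) atTop (𝓝 0) := by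
  have hsqrt : Tendsto Nat.sqrt atTop atTop :=
    tendsto_atTop_atTop.2 fun b => ⟨b * b, fun _ h => Nat.le_sqrt.2 h⟩
  have hlim : Tendsto (fun k : ℕ => ((τ * τ + τ : ℕ) : ENNReal) / (Nat.sqrt k : ℕ))
      atTop (𝓝 0) := by
    have := ENNReal.Tendsto.const_div (a := ((τ * τ + τ : ℕ) : ENNReal))
      (ENNReal.tendsto_nat_nhds_top.comp hsqrt) (Or.inr (ENNReal.natCast_ne_top _))
    simpa [Function.comp_def] using this
  refine tendsto_of_tendsto_of_tendsto_of_le_of_le' tendsto_const_nhds hlim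
    (Eventually.of_forall fun _ => zero_le) ?_
  filter_upwards [eventually_ge_atTop 1] with k hk
  -- The state `m` is new, as `B` only uses states below `m`.
  have hc : Fin.natAdd m (⟨0, hk⟩ : Fin k) ∉ range (Fin.castAdd k ∘ B) := by
    rintro ⟨i, hi⟩
    have := congrArg Fin.val hi
    simp at this
    have := (B i).2
    lia
  exact cond_rightExtends_le _ _ hc (Nat.sqrt_pos.2 hk)
    ((Nat.sqrt_le k).trans (Nat.le_add_left _ _)) fun f hf => hD k f hf _

/-- `A` and `B` are fixed labels over `ℤ_m`; for `n = m + k` they are regarded as labels over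
`ℤ_n ⊇ ℤ_m`, and `k`, hence `n`, tends to infinity. The conditional probability `μ[s|t]` is `0` by
convention when `t` has probability `0`, i.e. when no rule makes `A` right-extend to `B`. -/
theorem mainTheorem3 (τ : ℕ) [NeZero τ] (m : ℕ) (A B : Label τ m) :
    Tendsto (fun k : ℕ => (uniformRule (m + k))[
        {f | labelAssignmentDigraph f (Fin.castAdd k ∘ A) ∈ decidingDigraphs (Fin.castAdd k ∘ B)} |
        {f | labelAssignmentDigraph f (Fin.castAdd k ∘ A) ∈ extendingDigraphs (Fin.castAdd k ∘ B)}])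
      atTop (𝓝 0) ∧
    Tendsto (fun k : ℕ => (uniformRule (m + k))[
        {f | Decides f (Fin.castAdd k ∘ A) (Fin.castAdd k ∘ B)} |
        {f | RightExtends f (Fin.castAdd k ∘ A) (Fin.castAdd k ∘ B)}])
      atTop (𝓝 0) := by
  refine ⟨?_, tendsto_cond_rightExtends A B _ fun k f hf c => ?_⟩
  · simp only [labelAssignmentDigraph_mem_extendingDigraphs_iff]
    exact tendsto_cond_rightExtends A B _ fun k f hf c =>
      exists_orbit_mem_range_of_mem_decidingDigraphs hf c
  · obtain ⟨j, hj⟩ := hf.2 c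
    exact ⟨j, _, hj.symm⟩
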